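/- Let $n_1,n_2,n_e\ge 0$ be integers and $q=\max\{n_1,n_2,n_e\}$. The linear deterministic broadcast channel with receiver side information and an external eavesdropper has, in each channel use, an input $X\in\mathbb F_2^q$ and the outputs $$Y_1=D^{q-n_1}X,\qquad Y_2=D^{q-n_2}X,\qquad Z=D^{q-n_e}X$$ over $\mathbb F_2$ at receiver 1, receiver 2 and the eavesdropper, where $D$ is the $q\times q$ down-shift matrix; it is used $n$ times without memory. A code of block length $n$ consists of finite nonempty message sets $\mathcal M_1,\mathcal M_2$, an encoder $f:\mathcal M_1\times\mathcal M_2\to(\mathbb F_2^q)^n$, and decoders $g_1$ and $g_2$, where $g_1$ maps $(Y_1^n,M_2)$ to an estimate of $M_1$ and $g_2$ maps $(Y_2^n,M_1)$ to an estimate of $M_2$. The messages $M_1,M_2$ are independent and uniformly distributed on $\mathcal M_1,\mathcal M_2$, and $X^n=f(M_1,M_2)$. A rate pair $(R_1,R_2)$ is achievable if for every $\epsilon>0$ and all sufficiently large $n$ there is a code of block length $n$ such that, for $i=1,2$ and $j\ne i$, $$\Big|\tfrac1nH(M_i)-R_i\Big|\le\epsilon,\qquad \Pr\{g_i(Y_i^n,M_j)\ne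 M_i\}\le\epsilon,\qquad \tfrac1nI(M_i;Z^n)\le\epsilon,$$ with entropy and mutual information measured in bits. The individual secrecy capacity region is the set of all achievable rate pairs. **Theorem.** For all integers $n_1,n_2,n_e\ge 0$, the individual secrecy capacity region of the linear deterministic broadcast channel with receiver side information is exactly the set of all pairs $(R_1,R_2)$ of non-negative real numbers with $$R_1\le\min\{n_1,\,[n_1-n_e]^++R_2\},\qquad R_2\le\min\{n_2,\,[n_2-n_e]^++R_1\},$$ where $[a]^+=\max\{0,a\}$. The region is the same if the encoder is also allowed local randomness, that is, if $X^n$ is drawn from an arbitrary conditional distribution given $(M_1,M_2)$. -/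

import Mathlib

open Filter Matrix

noncomputable section

namespace IndividualSecrecy

/-- Shannon entropy, in bits, of the finitely-valued random variable `U` on the discrete
probability space `(Ω, P)`. -/
def entropy {Ω α : Type} [Fintype α] (P : PMF Ω) (U : Ω → α) : ℝ :=
  ∑ a, Real.negMulLog ((P.map U) a).toReal / Real.log 2

/-- Mutual information `I(U; V) = H(U) + H(V) - H(U, V)`, in bits. -/
def mutualInfo {Ω α β : Type} [Fintype α] [Fintype β] (P : PMF Ω) (U : Ω → α) (V : Ω → β) : ℝ :=
  entropy P U + entropy P V - entropy P (fun ω => (U ω, V ω))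

/-- A discrete memoryless broadcast channel with two legitimate receivers and an eavesdropper
all of whose outputs are functions of the input; one channel use maps the input letter `x` to
the output letters `y₁ x`, `y₂ x`, `z x`. -/
structure DetBC (𝒳 𝒴₁ 𝒴₂ 𝒵 : Type) where
  y₁ : 𝒳 → 𝒴₁
  y₂ : 𝒳 → 𝒴₂
  z : 𝒳 → 𝒵

/-- A code of block length `n` for the broadcast channel with receiver side information.
The message sets are `Fin L₁` and `Fin L₂`. The encoder may use local randomness: `enc m₁ m₂` is
the law of the channel input sequence. Receiver `1` knows `m₂`, and receiver `2` knows `m₁`. -/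
structure Code (𝒳 𝒴₁ 𝒴₂ : Type) (n : ℕ) where
  L₁ : ℕ
  L₂ : ℕ
  ne₁ : NeZero L₁
  ne₂ : NeZero L₂
  enc : Fin L₁ → Fin L₂ → PMF (Fin n → 𝒳)
  dec₁ : (Fin n → 𝒴₁) → Fin L₂ → Fin L₁
  dec₂ : (Fin n → 𝒴₂) → Fin L₁ → Fin L₂

namespace Code

variable {𝒳 𝒴₁ 𝒴₂ 𝒵 : Type} {n : ℕ}

attribute [instance] Code.ne₁ Code.ne₂

/-- The encoder is a mapping `(m₁, m₂) ↦ xⁿ`, without local randomness. -/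
def IsDeterministic (c : Code 𝒳 𝒴₁ 𝒴₂ n) : Prop :=
  ∃ f : Fin c.L₁ → Fin c.L₂ → Fin n → 𝒳, ∀ m₁ m₂, c.enc m₁ m₂ = PMF.pure (f m₁ m₂)

/-- Sample space of the triples `((m₁, m₂), xⁿ)`. -/
abbrev Sample (c : Code 𝒳 𝒴₁ 𝒴₂ n) : Type := (Fin c.L₁ × Fin c.L₂) × (Fin n → 𝒳)

/-- Joint law of the messages and the channel input sequence: the two messages are independent
and uniformly distributed. -/
def law (c : Code 𝒳 𝒴₁ 𝒴₂ n) : PMF c.Sample :=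
  (PMF.uniformOfFintype (Fin c.L₁ × Fin c.L₂)).bind
    fun m => (c.enc m.1 m.2).map fun x => (m, x)

/-- The message `M₁` as a random variable. -/
def M₁ (c : Code 𝒳 𝒴₁ 𝒴₂ n) (ω : c.Sample) : Fin c.L₁ := ω.1.1

/-- The message `M₂` as a random variable. -/
def M₂ (c : Code 𝒳 𝒴₁ 𝒴₂ n) (ω : c.Sample) : Fin c.L₂ := ω.1.2

/-- The sequence received by receiver `1`. -/
def Y₁ (c : Code 𝒳 𝒴₁ 𝒴₂ n) (W : DetBC 𝒳 𝒴₁ 𝒴₂ 𝒵) (ω : c.Sample) : Fin n → 𝒴₁ :=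
  fun t => W.y₁ (ω.2 t)

/-- The sequence received by receiver `2`. -/
def Y₂ (c : Code 𝒳 𝒴₁ 𝒴₂ n) (W : DetBC 𝒳 𝒴₁ 𝒴₂ 𝒵) (ω : c.Sample) : Fin n → 𝒴₂ :=
  fun t => W.y₂ (ω.2 t)

/-- The sequence received by the eavesdropper. -/
def Z (c : Code 𝒳 𝒴₁ 𝒴₂ n) (W : DetBC 𝒳 𝒴₁ 𝒴₂ 𝒵) (ω : c.Sample) : Fin n → 𝒵 :=
  fun t => W.z (ω.2 t)

/-- Average probability of decoding error at receiver `1`. -/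
def errorProb₁ (c : Code 𝒳 𝒴₁ 𝒴₂ n) (W : DetBC 𝒳 𝒴₁ 𝒴₂ 𝒵) : ℝ :=
  (c.law.toOuterMeasure {ω | c.M₁ ω ≠ c.dec₁ (c.Y₁ W ω) (c.M₂ ω)}).toReal

/-- Average probability of decoding error at receiver `2`. -/
def errorProb₂ (c : Code 𝒳 𝒴₁ 𝒴₂ n) (W : DetBC 𝒳 𝒴₁ 𝒴₂ 𝒵) : ℝ :=
  (c.law.toOuterMeasure {ω | c.M₂ ω ≠ c.dec₂ (c.Y₂ W ω) (c.M₁ ω)}).toReal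

/-- Up to `ε`, the code has rates `(R.1, R.2)`, is reliable at both receivers, and leaks
nothing about each individual message to the eavesdropper. -/
structure Meets [Fintype 𝒵] (c : Code 𝒳 𝒴₁ 𝒴₂ n) (W : DetBC 𝒳 𝒴₁ 𝒴₂ 𝒵) (R : ℝ × ℝ)
    (ε : ℝ) : Prop where
  rate₁ : |entropy c.law c.M₁ / n - R.1| ≤ ε
  rate₂ : |entropy c.law c.M₂ / n - R.2| ≤ ε
  reliable₁ : c.errorProb₁ W ≤ ε
  reliable₂ : c.errorProb₂ W ≤ ε
  secret₁ : mutualInfo c.law c.M₁ (c.Z W) / n ≤ ε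
  secret₂ : mutualInfo c.law c.M₂ (c.Z W) / n ≤ ε

end Code

/-- The individual secrecy capacity region (encoders are mappings): the set of achievable rate
pairs. -/
def capacityRegion {𝒳 𝒴₁ 𝒴₂ 𝒵 : Type} [Fintype 𝒵] (W : DetBC 𝒳 𝒴₁ 𝒴₂ 𝒵) : Set (ℝ × ℝ) :=
  {R | ∀ ε : ℝ, 0 < ε → ∀ᶠ n : ℕ in atTop,
    ∃ c : Code 𝒳 𝒴₁ 𝒴₂ n, c.IsDeterministic ∧ c.Meets W R ε}

/-- The individual secrecy capacity region when the encoder may use local randomness. -/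
def randomizedCapacityRegion {𝒳 𝒴₁ 𝒴₂ 𝒵 : Type} [Fintype 𝒵] (W : DetBC 𝒳 𝒴₁ 𝒴₂ 𝒵) :
    Set (ℝ × ℝ) :=
  {R | ∀ ε : ℝ, 0 < ε → ∀ᶠ n : ℕ in atTop, ∃ c : Code 𝒳 𝒴₁ 𝒴₂ n, c.Meets W R ε}

/-- Binary column vectors of length `q`; entry `0` is the top one. -/
abbrev Bits (q : ℕ) : Type := Fin q → ZMod 2

/-- The `q × q` down-shift matrix over the binary field. -/
def downShift (q : ℕ) : Matrix (Fin q) (Fin q) (ZMod 2) :=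
  Matrix.of fun i j => if (i : ℕ) = (j : ℕ) + 1 then 1 else 0

/-- The linear deterministic broadcast channel with gains `n₁`, `n₂`, `nₑ`. -/
def linearDetBC (n₁ n₂ nₑ : ℕ) :
    DetBC (Bits (max (max n₁ n₂) nₑ)) (Bits (max (max n₁ n₂) nₑ)) (Bits (max (max n₁ n₂) nₑ))
      (Bits (max (max n₁ n₂) nₑ)) where
  y₁ x := (downShift (max (max n₁ n₂) nₑ) ^ (max (max n₁ n₂) nₑ - n₁)) *ᵥ x
  y₂ x := (downShift (max (max n₁ n₂) nₑ) ^ (max (max n₁ n₂) nₑ - n₂)) *ᵥ x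
  z x := (downShift (max (max n₁ n₂) nₑ) ^ (max (max n₁ n₂) nₑ - nₑ)) *ᵥ x

/-- The set of non-negative rate pairs with `R₁ ≤ min {n₁, [n₁ - nₑ]⁺ + R₂}` and
`R₂ ≤ min {n₂, [n₂ - nₑ]⁺ + R₁}`. -/
def linearRegion (n₁ n₂ nₑ : ℕ) : Set (ℝ × ℝ) :=
  {R | 0 ≤ R.1 ∧ 0 ≤ R.2 ∧
    R.1 ≤ min (n₁ : ℝ) (max 0 ((n₁ : ℝ) - (nₑ : ℝ)) + R.2) ∧
    R.2 ≤ min (n₂ : ℝ) (max 0 ((n₂ : ℝ) - (nₑ : ℝ)) + R.1)}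

end IndividualSecrecy

end

/-!
Converse. Suppose receiver 1 recovers `M₁` from `(Y₁, M₂)` up to a small error. The output `Y₁` is a
function of `Z` and of the `[n₁ - nₑ]⁺` levels that lie below those of the eavesdropper, so `M₁` is
also recovered from `Z`, these levels and `M₂`. Fano's inequality (`entropy_pair_le_fano`) and
subadditivity then give `H(M₁, Z) ≤ H(Z) + n [n₁ - nₑ]⁺ + H(M₂) + small`, which is
`H(M₁) ≤ I(M₁; Z) + n [n₁ - nₑ]⁺ + H(M₂) + small` (`entropy_le_of_estimate`). The same inequality with
`M₂` in place of `Z`, a trivial variable in place of `M₂`, and all top `n₁` levels, gives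
`H(M₁) ≤ n n₁ + small`. Nothing here uses that the encoder is deterministic.

Fano's inequality, subadditivity and the bound by the logarithm of the alphabet size are all
instances of Gibbs' inequality (`sum_negMulLog_le`).

Achievability. Let the messages be strings of `k₁ = ⌊n R₁⌋` and `k₂ = ⌊n R₂⌋` bits, say with
`k₂ ≤ k₁`. The top positions carry the sum of the second message and the first `k₂` bits of the first
one; the other `k₁ - k₂` bits of the first message go below these positions and below the levels of
the eavesdropper, where receiver 1 still sees them because `k₁ ≤ n n₁` and
`k₁ - k₂ ≤ n [n₁ - nₑ]⁺` (`layout`, `isPerfectCode_layout`). Each receiver cancels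
the message it knows. The eavesdropper sees only bits of the sum, and a translation of either
message can be undone there by a translation of the other; as the messages are uniform, the
observation is independent of each of them (`mutualInfo_fst_eq_zero_of_translate`).
-/

open Filter Matrix

noncomputable section

namespace IndividualSecrecy

/-! ### Probability mass functions of finitely-valued random variables -/

/-- The real number `P (U = a)`. -/
def prob {Ω α : Type} (P : PMF Ω) (U : Ω → α) (a : α) : ℝ := ((P.map U) a).toReal

section Prob

variable {Ω Ω' α β γ : Type}

theorem prob_nonneg (P : PMF Ω) (U : Ω → α) (a : α) : 0 ≤ prob P U a := ENNReal.toReal_nonneg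

theorem prob_map (P : PMF Ω) (V : Ω → Ω') (U : Ω' → α) (a : α) :
    prob (P.map V) U a = prob P (fun ω => U (V ω)) a := by
  simp only [prob, PMF.map_comp]; rfl

theorem sum_prob [Fintype α] (P : PMF Ω) (U : Ω → α) : ∑ a, prob P U a = 1 := by
  unfold prob
  rw [← ENNReal.toReal_sum fun a _ => PMF.apply_ne_top _ a, ← tsum_fintype (L := .unconditional _),
    PMF.tsum_coe, ENNReal.toReal_one]

open Classical in
theorem prob_comp [Fintype α] (P : PMF Ω) (U : Ω → α) (f : α → β) (b : β) :
    prob P (fun ω => f (U ω)) b = ∑ a, if b = f a then prob P U a else 0 := by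
  have h : P.map (fun ω => f (U ω)) = (P.map U).map f := by rw [PMF.map_comp]; rfl
  unfold prob
  rw [h, PMF.map_apply, tsum_fintype, ENNReal.toReal_sum]
  · refine Finset.sum_congr rfl fun a _ => ?_
    split_ifs <;> simp
  · intro a _
    split_ifs
    · exact PMF.apply_ne_top _ a
    · simp

theorem prob_le_prob_comp [Fintype α] (P : PMF Ω) (U : Ω → α) (f : α → β) (a : α) :
    prob P U a ≤ prob P (fun ω => f (U ω)) (f a) := by
  classical
  rw [prob_comp P U f]
  have := Finset.single_le_sum (s := Finset.univ)
    (f := fun a' => if f a = f a' then prob P U a' else 0)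
    (fun i _ => by split_ifs; exacts [prob_nonneg _ _ _, le_rfl]) (Finset.mem_univ a)
  simpa using this

/-- The expectation of `g (f U)` can be computed from the law of `U` or from that of `f U`. -/
theorem sum_prob_mul_comp [Fintype α] [Fintype β] (P : PMF Ω) (U : Ω → α) (f : α → β)
    (g : β → ℝ) :
    ∑ a, prob P U a * g (f a) = ∑ b, prob P (fun ω => f (U ω)) b * g b := by
  classical
  simp only [prob_comp, Finset.sum_mul]
  rw [Finset.sum_comm]
  refine Finset.sum_congr rfl fun a _ => ?_
  simp

theorem prob_fst [Fintype α] [Fintype β] (P : PMF Ω) (U : Ω → α) (V : Ω → β) (a : α) :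
    prob P U a = ∑ b, prob P (fun ω => (U ω, V ω)) (a, b) := by
  classical
  have := prob_comp P (fun ω => (U ω, V ω)) Prod.fst a
  rw [Fintype.sum_prod_type, Finset.sum_comm] at this
  simpa using this

theorem prob_snd [Fintype α] [Fintype β] (P : PMF Ω) (U : Ω → α) (V : Ω → β) (b : β) :
    prob P V b = ∑ a, prob P (fun ω => (U ω, V ω)) (a, b) := by
  classical
  have := prob_comp P (fun ω => (U ω, V ω)) Prod.snd b
  rw [Fintype.sum_prod_type_right, Finset.sum_comm] at this
  simpa using this

open Classical in
theorem toReal_toOuterMeasure_eq_sum [Fintype α] (P : PMF Ω) (U : Ω → α) (s : Set α) :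
    (P.toOuterMeasure {ω | U ω ∈ s}).toReal = ∑ a, if a ∈ s then prob P U a else 0 := by
  have h := PMF.toOuterMeasure_map_apply U P s
  rw [show {ω | U ω ∈ s} = U ⁻¹' s from rfl, ← h, PMF.toOuterMeasure_apply_fintype,
    ENNReal.toReal_sum]
  · refine Finset.sum_congr rfl fun a _ => ?_
    by_cases ha : a ∈ s <;> simp only [Set.indicator, ha, prob, if_true, if_false,
      ENNReal.toReal_zero]
  · intro a _
    by_cases ha : a ∈ s <;> simp only [Set.indicator, ha, if_true, if_false, ne_eq,
      PMF.apply_ne_top, not_false_eq_true, ENNReal.zero_ne_top]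

/-- A bijection of the sample space preserves the uniform law. -/
theorem prob_uniform_congr {S : Type} [Fintype S] [Nonempty S] (σ : S ≃ S) (U : S → α) (a a' : α)
    (h : ∀ s, U (σ s) = a' ↔ U s = a) :
    prob (PMF.uniformOfFintype S) U a = prob (PMF.uniformOfFintype S) U a' := by
  classical
  simp only [prob, PMF.map_apply, PMF.uniformOfFintype_apply, tsum_fintype]
  rw [← Equiv.sum_comp σ fun s => if a' = U s then _ else _]
  congr 1
  refine Finset.sum_congr rfl fun s _ => ?_
  simp only [eq_comm (a := a'), eq_comm (a := a), h]

theorem map_equiv_uniformOfFintype {α β : Type} [Fintype α] [Fintype β] [Nonempty α] [Nonempty β]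
    (e : α ≃ β) : (PMF.uniformOfFintype α).map e = PMF.uniformOfFintype β := by
  classical
  ext b
  rw [PMF.map_apply, tsum_eq_single (e.symm b)]
  · simp [Fintype.card_congr e]
  · intro a ha
    rw [if_neg]
    rintro rfl
    simp at ha

end Prob

/-! ### Entropy -/

section Entropy

variable {Ω Ω' α β γ : Type} [Fintype α] [Fintype β]

theorem log_two_pos : 0 < Real.log 2 := Real.log_pos one_lt_two

theorem entropy_eq_sum_div (P : PMF Ω) (U : Ω → α) :
    entropy P U = (∑ a, Real.negMulLog (prob P U a)) / Real.log 2 := by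
  rw [entropy, Finset.sum_div]; rfl

theorem entropy_map (P : PMF Ω) (V : Ω → Ω') (U : Ω' → α) :
    entropy (P.map V) U = entropy P (fun ω => U (V ω)) := by
  simp only [entropy_eq_sum_div, prob_map]

theorem mutualInfo_map (P : PMF Ω) (W : Ω → Ω') (U : Ω' → α) (V : Ω' → β) :
    mutualInfo (P.map W) U V = mutualInfo P (fun ω => U (W ω)) (fun ω => V (W ω)) := by
  simp only [mutualInfo, entropy_map]

theorem prob_le_one (P : PMF Ω) (U : Ω → α) (a : α) : prob P U a ≤ 1 := by
  rw [← sum_prob P U]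
  exact Finset.single_le_sum (fun i _ => prob_nonneg P U i) (Finset.mem_univ a)

theorem entropy_nonneg (P : PMF Ω) (U : Ω → α) : 0 ≤ entropy P U := by
  rw [entropy_eq_sum_div]
  exact div_nonneg (Finset.sum_nonneg fun a _ =>
    Real.negMulLog_nonneg (prob_nonneg P U a) (prob_le_one P U a)) log_two_pos.le

/-- Gibbs' inequality, for a reference weight `q` of total mass at most that of `p`. -/
theorem sum_negMulLog_le {ι : Type} [Fintype ι] (p q : ι → ℝ) (hp : ∀ i, 0 ≤ p i)
    (hq : ∀ i, 0 ≤ q i) (hpq : ∀ i, q i = 0 → p i = 0) (hs : ∑ i, q i ≤ ∑ i, p i) :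
    ∑ i, Real.negMulLog (p i) ≤ ∑ i, -(p i * Real.log (q i)) := by
  have key : ∀ i, Real.negMulLog (p i) + p i * Real.log (q i) ≤ q i - p i := by
    intro i
    rcases (hp i).eq_or_lt with h | h
    · simp [← h, hq i]
    · have hqi : 0 < q i := (hq i).lt_of_ne fun h0 => h.ne' (hpq i h0.symm)
      have h1 := Real.log_le_sub_one_of_pos (div_pos hqi h)
      rw [Real.log_div hqi.ne' h.ne'] at h1
      have h2 := mul_le_mul_of_nonneg_left h1 h.le
      have h3 : p i * (q i / p i - 1) = q i - p i := by field_simp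
      rw [Real.negMulLog]
      nlinarith
  have h := Finset.sum_le_sum fun i (_ : i ∈ Finset.univ) => key i
  rw [Finset.sum_add_distrib, Finset.sum_sub_distrib] at h
  rw [Finset.sum_neg_distrib]
  linarith

theorem sum_negMulLog_prob (P : PMF Ω) (U : Ω → α) :
    ∑ a, Real.negMulLog (prob P U a) = -∑ a, prob P U a * Real.log (prob P U a) := by
  simp [Real.negMulLog]

theorem entropy_comp_le (P : PMF Ω) (U : Ω → α) (f : α → β) :
    entropy P (fun ω => f (U ω)) ≤ entropy P U := by
  rw [entropy_eq_sum_div, entropy_eq_sum_div]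
  refine div_le_div_of_nonneg_right ?_ log_two_pos.le
  rw [sum_negMulLog_prob, sum_negMulLog_prob,
    ← sum_prob_mul_comp P U f fun b => Real.log (prob P (fun ω => f (U ω)) b)]
  refine neg_le_neg (Finset.sum_le_sum fun a _ => ?_)
  rcases (prob_nonneg P U a).eq_or_lt with h | h
  · simp [← h]
  · exact mul_le_mul_of_nonneg_left (Real.log_le_log h (prob_le_prob_comp P U f a)) h.le

theorem entropy_pair_le_add (P : PMF Ω) (U : Ω → α) (V : Ω → β) :
    entropy P (fun ω => (U ω, V ω)) ≤ entropy P U + entropy P V := by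
  simp only [entropy_eq_sum_div]
  rw [← add_div]
  refine div_le_div_of_nonneg_right ?_ log_two_pos.le
  have hU (x : α × β) := prob_le_prob_comp P (fun ω => (U ω, V ω)) Prod.fst x
  have hV (x : α × β) := prob_le_prob_comp P (fun ω => (U ω, V ω)) Prod.snd x
  have hn (x : α × β) := prob_nonneg P (fun ω => (U ω, V ω)) x
  refine (sum_negMulLog_le _ (fun x : α × β => prob P U x.1 * prob P V x.2) hn
    (fun x => mul_nonneg (prob_nonneg _ _ _) (prob_nonneg _ _ _)) ?_ ?_).trans ?_
  · intro x hx
    rcases mul_eq_zero.1 hx with h | h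
    · exact le_antisymm ((hU x).trans h.le) (hn x)
    · exact le_antisymm ((hV x).trans h.le) (hn x)
  · rw [sum_prob, Fintype.sum_prod_type]
    simp only [← Finset.mul_sum, sum_prob, mul_one, le_refl]
  · have e1 := sum_prob_mul_comp P (fun ω => (U ω, V ω)) Prod.fst fun a => Real.log (prob P U a)
    have e2 := sum_prob_mul_comp P (fun ω => (U ω, V ω)) Prod.snd fun a => Real.log (prob P V a)
    rw [sum_negMulLog_prob P U, sum_negMulLog_prob P V, ← neg_add]
    simp only at e1 e2
    rw [← e1, ← e2, ← Finset.sum_add_distrib, Finset.sum_neg_distrib]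
    refine le_of_eq (congrArg _ (Finset.sum_congr rfl fun x _ => ?_))
    rcases (hn x).eq_or_lt with h | h
    · simp [← h]
    · rw [Real.log_mul (h.trans_le (hU x)).ne' (h.trans_le (hV x)).ne', mul_add]

theorem entropy_le_log_card [Nonempty α] (P : PMF Ω) (U : Ω → α) :
    entropy P U ≤ Real.log (Fintype.card α) / Real.log 2 := by
  rw [entropy_eq_sum_div]
  refine div_le_div_of_nonneg_right ?_ log_two_pos.le
  have hc : (0 : ℝ) < Fintype.card α := by exact_mod_cast Fintype.card_pos
  refine (sum_negMulLog_le _ (fun _ => (Fintype.card α : ℝ)⁻¹) (prob_nonneg P U)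
    (fun _ => by positivity) (fun _ h => absurd h (by positivity)) ?_).trans ?_
  · rw [sum_prob]; simp [hc.ne']
  · simp [← Finset.sum_mul, sum_prob]

/-- Fano's inequality: if `U` is estimated by `g V`, with `V` known, then
`H(U | V) ≤ 1 + P (U ≠ g V) * log₂ |α|`. It is Gibbs' inequality for the reference law of `U`
given `V` that gives mass `1 / 2` to `g V` and at least `1 / (2 |α|)` to any other value. -/
theorem entropy_pair_le_fano [Nonempty α] (P : PMF Ω) (U : Ω → α) (V : Ω → β) (g : β → α) :
    entropy P (fun ω => (U ω, V ω)) ≤ entropy P V + (1 +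
      (P.toOuterMeasure {ω | U ω ≠ g (V ω)}).toReal *
        (Real.log (Fintype.card α) / Real.log 2)) := by
  classical
  have hc : (0 : ℝ) < Fintype.card α := by exact_mod_cast Fintype.card_pos
  have hl := log_two_pos
  have hV (x : α × β) := prob_le_prob_comp P (fun ω => (U ω, V ω)) Prod.snd x
  have hn (x : α × β) := prob_nonneg P (fun ω => (U ω, V ω)) x
  have hd : (P.toOuterMeasure {ω | U ω ≠ g (V ω)}).toReal =
      ∑ x : α × β, if x.1 ≠ g x.2 then prob P (fun ω => (U ω, V ω)) x else 0 := by
    refine (toReal_toOuterMeasure_eq_sum P (fun ω => (U ω, V ω)) {x | x.1 ≠ g x.2}).trans ?_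
    exact Finset.sum_congr rfl fun x _ => by congr
  let r : α × β → ℝ := fun x => if x.1 ≠ g x.2 then (2 * Fintype.card α : ℝ)⁻¹ else 2⁻¹
  have hr (x) : 0 < r x := by simp only [r]; split_ifs <;> positivity
  have hrs (b : β) : ∑ a, r (a, b) ≤ 1 := by
    have : ∀ a, r (a, b) ≤ (2 * Fintype.card α : ℝ)⁻¹ + if a = g b then 2⁻¹ else 0 := by
      intro a
      by_cases h : a = g b
      · simp only [r, h, ne_eq, not_true_eq_false, if_false, if_true]
        have : 0 < (2 * Fintype.card α : ℝ)⁻¹ := by positivity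
        linarith
      · simp [r, h]
    refine (Finset.sum_le_sum fun a _ => this a).trans ?_
    rw [Finset.sum_add_distrib, Finset.sum_ite_eq' Finset.univ (g b)]
    simp only [Finset.sum_const, Finset.card_univ, nsmul_eq_mul, Finset.mem_univ, if_true]
    have : (Fintype.card α : ℝ) * (2 * Fintype.card α : ℝ)⁻¹ = 2⁻¹ := by field_simp
    rw [this]; norm_num
  have main := sum_negMulLog_le _ (fun x : α × β => prob P V x.2 * r x) hn
    (fun x => mul_nonneg (prob_nonneg _ _ _) (hr x).le) (fun x hx => by
      have h := (mul_eq_zero.1 hx).resolve_right (hr x).ne'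
      exact le_antisymm ((hV x).trans h.le) (hn x)) (by
      rw [sum_prob, Fintype.sum_prod_type_right]
      simp only [← Finset.mul_sum]
      rw [← sum_prob P V]
      exact Finset.sum_le_sum fun b _ => mul_le_of_le_one_right (prob_nonneg _ _ _) (hrs b))
  have e2 := sum_prob_mul_comp P (fun ω => (U ω, V ω)) Prod.snd fun a => Real.log (prob P V a)
  have hterm (x : α × β) : prob P (fun ω => (U ω, V ω)) x * Real.log (prob P V x.2 * r x) =
      prob P (fun ω => (U ω, V ω)) x * Real.log (prob P V x.2) -
        (prob P (fun ω => (U ω, V ω)) x * Real.log 2 +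
        (if x.1 ≠ g x.2 then prob P (fun ω => (U ω, V ω)) x else 0) *
          Real.log (Fintype.card α)) := by
    rcases (hn x).eq_or_lt with h | h
    · simp [← h]
    · rw [Real.log_mul (h.trans_le (hV x)).ne' (hr x).ne']
      simp only [r]
      split_ifs
      · rw [Real.log_inv, Real.log_mul two_ne_zero hc.ne']; ring
      · rw [Real.log_inv]; ring
  simp only [hterm, Finset.sum_neg_distrib] at main
  rw [Finset.sum_sub_distrib, Finset.sum_add_distrib, ← Finset.sum_mul, ← Finset.sum_mul, sum_prob,
    e2, ← hd] at main
  rw [entropy_eq_sum_div, entropy_eq_sum_div, sum_negMulLog_prob P V, div_le_iff₀ hl]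
  refine main.trans (le_of_eq ?_)
  field_simp
  ring

/-- Variables whose joint law is a product law share no information. -/
theorem mutualInfo_eq_zero_of_prob_mul (P : PMF Ω) (U : Ω → α) (V : Ω → β)
    (h : ∀ a b, prob P (fun ω => (U ω, V ω)) (a, b) = prob P U a * prob P V b) :
    mutualInfo P U V = 0 := by
  simp only [mutualInfo, entropy_eq_sum_div]
  rw [← add_div, ← sub_div, Fintype.sum_prod_type]
  simp only [h, Real.negMulLog_mul, Finset.sum_add_distrib, ← Finset.mul_sum, ← Finset.sum_mul,
    sum_prob]
  simp

theorem entropy_of_prob_const [Nonempty α] (P : PMF Ω) (U : Ω → α)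
    (h : ∀ a a', prob P U a = prob P U a') :
    entropy P U = Real.log (Fintype.card α) / Real.log 2 := by
  have hc : (Fintype.card α : ℝ) ≠ 0 := by exact_mod_cast Fintype.card_ne_zero
  have hp (a) : prob P U a = (Fintype.card α : ℝ)⁻¹ := by
    have := sum_prob P U
    rw [Finset.sum_congr rfl fun a' _ => h a' a] at this
    simp only [Finset.sum_const, Finset.card_univ, nsmul_eq_mul] at this
    field_simp
    linarith
  rw [entropy_eq_sum_div]
  simp only [hp, Finset.sum_const, Finset.card_univ, nsmul_eq_mul, Real.negMulLog, Real.log_inv]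
  field_simp

/-- If the joint probability of `(U, V) = (a, b)` does not depend on `a`, then `U` is uniform and
independent of `V`. -/
theorem mutualInfo_eq_zero_of_prob_const [Nonempty α] (P : PMF Ω) (U : Ω → α) (V : Ω → β)
    (h : ∀ a a' b, prob P (fun ω => (U ω, V ω)) (a, b) = prob P (fun ω => (U ω, V ω)) (a', b)) :
    mutualInfo P U V = 0 := by
  refine mutualInfo_eq_zero_of_prob_mul P U V fun a b => ?_
  have hU (a') : prob P U a' = prob P U a := by
    rw [prob_fst P U V a', prob_fst P U V a]
    exact Finset.sum_congr rfl fun b _ => h a' a b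
  have h1 := sum_prob P U
  rw [Finset.sum_congr rfl fun a' _ => hU a'] at h1
  rw [prob_snd P U V b, Finset.sum_congr rfl fun a' _ => h a' a b]
  simp only [Finset.sum_const, Finset.card_univ, nsmul_eq_mul] at h1 ⊢
  linear_combination -(prob P (fun ω => (U ω, V ω)) (a, b)) * h1

theorem entropy_const {Ω : Type} (P : PMF Ω) : entropy P (fun _ => ()) = 0 := by
  refine le_antisymm ?_ (entropy_nonneg _ _)
  simpa using entropy_le_log_card P (fun _ => ())

theorem mutualInfo_comm {Ω α β : Type} [Fintype α] [Fintype β] (P : PMF Ω) (U : Ω → α)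
    (V : Ω → β) : mutualInfo P U V = mutualInfo P V U := by
  have h1 := entropy_comp_le P (fun ω => (U ω, V ω)) Prod.swap
  have h2 := entropy_comp_le P (fun ω => (V ω, U ω)) Prod.swap
  simp only [Prod.swap_prod_mk] at h1 h2
  unfold mutualInfo
  linarith

theorem entropy_comp_equiv {Ω α β : Type} [Fintype α] [Fintype β] (P : PMF Ω) (U : Ω → α)
    (e : α ≃ β) : entropy P (fun ω => e (U ω)) = entropy P U := by
  refine (entropy_comp_le P U e).antisymm ?_
  simpa using entropy_comp_le P (fun ω => e (U ω)) e.symm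

theorem mutualInfo_comp_equiv {Ω α β γ : Type} [Fintype α] [Fintype β] [Fintype γ] (P : PMF Ω)
    (U : Ω → α) (V : Ω → γ) (e : α ≃ β) :
    mutualInfo P (fun ω => e (U ω)) V = mutualInfo P U V := by
  have h := entropy_comp_equiv P (fun ω => (U ω, V ω)) (e.prodCongr (Equiv.refl γ))
  simp only [Equiv.prodCongr_apply, Prod.map_apply, Equiv.refl_apply] at h
  rw [mutualInfo, mutualInfo, entropy_comp_equiv, h]

end Entropy
/-! ### The law of a code -/

namespace Code

variable {𝒳 𝒴₁ 𝒴₂ 𝒵 : Type} {n : ℕ} (c : Code 𝒳 𝒴₁ 𝒴₂ n)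

theorem map_fst_law :
    c.law.map Prod.fst = PMF.uniformOfFintype (Fin c.L₁ × Fin c.L₂) := by
  rw [law, PMF.map_bind]
  conv_rhs => rw [← PMF.bind_pure (PMF.uniformOfFintype (Fin c.L₁ × Fin c.L₂))]
  congr 1
  funext m
  rw [PMF.map_comp]
  exact PMF.map_const _ _

theorem entropy_M₁ : entropy c.law c.M₁ = Real.log c.L₁ / Real.log 2 := by
  have h := entropy_map c.law Prod.fst (Prod.fst : Fin c.L₁ × Fin c.L₂ → Fin c.L₁)
  rw [map_fst_law] at h
  refine h.symm.trans ?_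
  rw [entropy_of_prob_const, Fintype.card_fin]
  exact fun a a' => prob_uniform_congr (Equiv.prodCongr (Equiv.swap a a') (Equiv.refl _)) _ _ _
    fun s => by simp [Equiv.swap_apply_eq_iff]

theorem entropy_M₂ : entropy c.law c.M₂ = Real.log c.L₂ / Real.log 2 := by
  have h := entropy_map c.law Prod.fst (Prod.snd : Fin c.L₁ × Fin c.L₂ → Fin c.L₂)
  rw [map_fst_law] at h
  refine h.symm.trans ?_
  rw [entropy_of_prob_const, Fintype.card_fin]
  exact fun a a' => prob_uniform_congr (Equiv.prodCongr (Equiv.refl _) (Equiv.swap a a')) _ _ _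
    fun s => by simp [Equiv.swap_apply_eq_iff]

theorem mutualInfo_messages : mutualInfo c.law c.M₁ c.M₂ = 0 := by
  have h := mutualInfo_map c.law Prod.fst (Prod.fst : Fin c.L₁ × Fin c.L₂ → Fin c.L₁) Prod.snd
  rw [map_fst_law] at h
  refine h.symm.trans (mutualInfo_eq_zero_of_prob_const _ _ _ fun a a' b => ?_)
  exact prob_uniform_congr (Equiv.prodCongr (Equiv.swap a a') (Equiv.refl _)) _ _ _
    fun s => by simp [Equiv.swap_apply_eq_iff, Prod.ext_iff]

end Code

/-! ### The levels of the shift channel -/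

theorem downShift_apply {q : ℕ} (i j : Fin q) :
    downShift q i j = if (i : ℕ) = (j : ℕ) + 1 then 1 else 0 := rfl

theorem downShift_pow_apply {q : ℕ} (k : ℕ) (i j : Fin q) :
    (downShift q ^ k) i j = if (i : ℕ) = (j : ℕ) + k then 1 else 0 := by
  induction k generalizing i j with
  | zero => simp [Matrix.one_apply, Fin.ext_iff]
  | succ k ih =>
    rw [pow_succ', Matrix.mul_apply]
    simp only [ih, downShift_apply]
    by_cases h : (i : ℕ) = j + (k + 1)
    · rw [if_pos h, Finset.sum_eq_single ⟨j + k, by have := i.2; omega⟩]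
      · simp [h, add_assoc]
      · intro b _ hb
        rw [if_neg (c := (b : ℕ) = j + k) fun h' => hb (Fin.ext h'), mul_zero]
      · simp
    · rw [if_neg h]
      refine Finset.sum_eq_zero fun b _ => ?_
      split_ifs <;> first | omega | simp

theorem downShift_pow_mulVec_apply {q : ℕ} (k : ℕ) (x : Bits q) (i : Fin q) :
    ((downShift q ^ k) *ᵥ x) i = if k ≤ (i : ℕ) then x ⟨i - k, by omega⟩ else 0 := by
  simp only [Matrix.mulVec, dotProduct, downShift_pow_apply, ite_mul, one_mul, zero_mul]
  split_ifs with h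
  · rw [Finset.sum_eq_single ⟨i - k, by omega⟩]
    · rw [if_pos (by simp; omega)]
    · intro b _ hb
      exact if_neg fun h' => hb (Fin.ext (by simp; omega))
    · simp
  · exact Finset.sum_eq_zero fun b _ => if_neg (by omega)

/-- The output of a shift channel of gain `m` amounts to the top `m` levels of the input. -/
theorem downShift_pow_mulVec_eq_iff {q m : ℕ} (hm : m ≤ q) (x y : Bits q) :
    (downShift q ^ (q - m)) *ᵥ x = (downShift q ^ (q - m)) *ᵥ y ↔
      ∀ j : Fin q, (j : ℕ) < m → x j = y j := by
  constructor
  · intro h j hj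
    have := congrFun h ⟨j + (q - m), by omega⟩
    simpa [downShift_pow_mulVec_apply] using this
  · intro h
    ext i
    simp only [downShift_pow_mulVec_apply]
    split_ifs with hi
    · exact h _ (by simp; omega)
    · rfl

/-- The bits of an input sequence at the levels from `l` up to but not including `m`. -/
def levels (q n l m : ℕ) (x : Fin n → Bits q) :
    Fin n → {j : Fin q // l ≤ (j : ℕ) ∧ (j : ℕ) < m} → ZMod 2 :=
  fun t j => x t j

theorem log_card_levels_le (q n l m : ℕ) :
    Real.log (Fintype.card (Fin n → {j : Fin q // l ≤ (j : ℕ) ∧ (j : ℕ) < m} → ZMod 2)) /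
      Real.log 2 ≤ n * max 0 ((m : ℝ) - l) := by
  have hcard : Fintype.card {j : Fin q // l ≤ (j : ℕ) ∧ (j : ℕ) < m} ≤ m - l := by
    rw [← Nat.card_Ico, ← Fintype.card_coe]
    refine Fintype.card_le_of_injective (fun j => ⟨j.1, Finset.mem_Ico.2 j.2⟩) fun a b h => ?_
    simpa [Subtype.ext_iff, Fin.ext_iff] using h
  have hsub : ((m - l : ℕ) : ℝ) ≤ max 0 ((m : ℝ) - l) := by
    rcases le_total l m with h | h
    · rw [Nat.cast_sub h]; exact le_max_right _ _
    · simp [Nat.sub_eq_zero_of_le h]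
  simp only [Fintype.card_fun, Fintype.card_fin, ZMod.card, Nat.cast_pow, Real.log_pow,
    Nat.cast_ofNat]
  rw [← mul_assoc, mul_div_assoc, div_self log_two_pos.ne', mul_one]
  gcongr
  exact (Nat.cast_le.2 hcard).trans hsub

/-! ### Converse -/

/-- If `U` can be estimated from `(Z, V, W)` by `g`, then all of `U` beyond what `Z` reveals is
paid for by `V`, by `W`, or by the estimation error. -/
theorem entropy_le_of_estimate {Ω α β ζ η : Type} [Fintype α] [Fintype β] [Fintype ζ] [Fintype η]
    [Nonempty α] [Nonempty η] (P : PMF Ω) (U : Ω → α) (W : Ω → β) (Z : Ω → ζ) (V : Ω → η)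
    (g : (ζ × η) × β → α) :
    entropy P U ≤ mutualInfo P U Z + entropy P W + Real.log (Fintype.card η) / Real.log 2 + 1 +
      (P.toOuterMeasure {ω | U ω ≠ g ((Z ω, V ω), W ω)}).toReal *
        (Real.log (Fintype.card α) / Real.log 2) := by
  have h1 := entropy_comp_le P (fun ω => (U ω, ((Z ω, V ω), W ω))) fun x => (x.1, x.2.1.1)
  have h2 := entropy_pair_le_fano P U (fun ω => ((Z ω, V ω), W ω)) g
  have h3 := entropy_pair_le_add P (fun ω => (Z ω, V ω)) W
  have h4 := entropy_pair_le_add P Z V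
  have h5 := entropy_le_log_card P V
  simp only [mutualInfo] at *
  linarith

/-- The entropy bounds satisfied by the message `U` of one receiver, which knows the other
message `W` and is served by a shift channel of gain `m`, when the eavesdropper's channel has
gain `l`. -/
theorem entropy_le_of_shift {Ω α β : Type} [Fintype α] [Fintype β] [Nonempty α] {q n l m : ℕ}
    (hl : l ≤ q) (hm : m ≤ q) (P : PMF Ω) (U : Ω → α) (W : Ω → β) (X : Ω → Fin n → Bits q)
    (g : (Fin n → Bits q) → β → α) (hU : entropy P U = Real.log (Fintype.card α) / Real.log 2)
    (hUW : mutualInfo P U W = 0) {ε : ℝ}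
    (hε : (P.toOuterMeasure
      {ω | U ω ≠ g (fun t => (downShift q ^ (q - m)) *ᵥ X ω t) (W ω)}).toReal ≤ ε) :
    entropy P U ≤ n * m + 1 + ε * entropy P U ∧
    entropy P U ≤ mutualInfo P U (fun ω t => (downShift q ^ (q - l)) *ᵥ X ω t) + entropy P W +
      n * max 0 ((m : ℝ) - l) + 1 + ε * entropy P U := by
  have hUnn := entropy_nonneg P U
  constructor
  -- Here the known message `W` takes the place of the eavesdropper's observation: as `W` shares no
  -- information with `U`, all of `U` is paid for by the top `m` levels.
  · obtain ⟨F, hF⟩ := (Function.factorsThrough_iff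
      (f := levels q n 0 m) (fun x t => (downShift q ^ (q - m)) *ᵥ x t)).1 (by
        intro x y h
        funext t
        exact (downShift_pow_mulVec_eq_iff hm _ _).2 fun j hj =>
          congrFun (congrFun h t) ⟨j, Nat.zero_le _, hj⟩)
    have h := entropy_le_of_estimate P U (fun _ => ()) W (fun ω => levels q n 0 m (X ω))
      fun v => g (F v.1.2) v.1.1
    have hc := log_card_levels_le q n 0 m
    have hFx (x) : F (levels q n 0 m x) = fun t => (downShift q ^ (q - m)) *ᵥ x t :=
      (congrFun hF x).symm
    simp only [hFx, hUW, entropy_const, ← hU] at h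
    have := mul_le_mul_of_nonneg_right hε hUnn
    simp only [Nat.cast_zero, sub_zero, max_eq_right (Nat.cast_nonneg (α := ℝ) m)] at hc
    linarith
  -- The eavesdropper's output and the levels from `l` to `m` determine the receiver's output.
  · obtain ⟨F, hF⟩ := (Function.factorsThrough_iff
      (f := fun x : Fin n → Bits q =>
        ((fun t => (downShift q ^ (q - l)) *ᵥ x t), levels q n l m x))
      (fun x t => (downShift q ^ (q - m)) *ᵥ x t)).1 (by
        intro x y h
        funext t
        refine (downShift_pow_mulVec_eq_iff hm _ _).2 fun j hj => ?_
        rcases lt_or_ge (j : ℕ) l with hj' | hj'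
        · exact (downShift_pow_mulVec_eq_iff hl _ _).1 (congrFun (congrArg Prod.fst h) t) j hj'
        · exact congrFun (congrFun (congrArg Prod.snd h) t) ⟨j, hj', hj⟩)
    have h := entropy_le_of_estimate P U W (fun ω t => (downShift q ^ (q - l)) *ᵥ X ω t)
      (fun ω => levels q n l m (X ω)) fun v => g (F v.1) v.2
    have hc := log_card_levels_le q n l m
    have hFx (x) : F ((fun t => (downShift q ^ (q - l)) *ᵥ x t), levels q n l m x) =
        fun t => (downShift q ^ (q - m)) *ᵥ x t := (congrFun hF x).symm
    simp only [hFx, ← hU] at h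
    have := mul_le_mul_of_nonneg_right hε hUnn
    linarith

/-- The entropy bounds per channel use: `N ≥ 1 / ε` is the block length, `h` and `k` are the
entropies of a message and of the other one, and `i` is the leakage of the first. -/
theorem rate_le_of_entropy_le {N R S ε h k m a : ℝ} (hN : 0 < N) (hNε : 1 ≤ ε * N) (hε : 0 ≤ ε)
    (hh : |h / N - R| ≤ ε) (hk : |k / N - S| ≤ ε) {i : ℝ} (hi : i / N ≤ ε)
    (h1 : h ≤ N * m + 1 + ε * h) (h2 : h ≤ i + k + N * a + 1 + ε * h) :
    R ≤ m + ε * (4 + R + ε) ∧ R ≤ a + S + ε * (4 + R + ε) := by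
  rw [abs_le] at hh hk
  have e1 : h / N ≤ m + ε + ε * (h / N) := by
    rw [div_le_iff₀ hN]
    have : (m + ε + ε * (h / N)) * N = N * m + ε * N + ε * h := by field_simp
    linarith
  have e2 : h / N ≤ i / N + k / N + a + ε + ε * (h / N) := by
    rw [div_le_iff₀ hN]
    have : (i / N + k / N + a + ε + ε * (h / N)) * N = i + k + N * a + ε * N + ε * h := by
      field_simp
    linarith
  have e3 : ε * (h / N) ≤ ε * (R + ε) := mul_le_mul_of_nonneg_left (by linarith) hε
  constructor <;> nlinarith

theorem exists_pos_mul_lt {b : ℝ} (hb : 0 ≤ b) {a : ℝ} (ha : 0 < a) :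
    ∃ ε : ℝ, 0 < ε ∧ ε * (b + ε) < a := by
  refine ⟨min 1 (a / (2 * (b + 1))), by positivity, ?_⟩
  have h1 : min 1 (a / (2 * (b + 1))) ≤ 1 := min_le_left _ _
  calc _ ≤ a / (2 * (b + 1)) * (b + 1) := by gcongr; exact min_le_right _ _
    _ = a / 2 := by field_simp
    _ < a := by linarith

theorem le_of_forall_pos_le_add_mul {x y b : ℝ} (hb : 0 ≤ b)
    (h : ∀ ε : ℝ, 0 < ε → x ≤ y + ε * (b + ε)) : x ≤ y := by
  by_contra! hlt
  obtain ⟨ε, hε, hlt'⟩ := exists_pos_mul_lt hb (sub_pos.2 hlt)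
  linarith [h ε hε]

theorem randomizedCapacityRegion_subset (n₁ n₂ nₑ : ℕ) :
    randomizedCapacityRegion (linearDetBC n₁ n₂ nₑ) ⊆ linearRegion n₁ n₂ nₑ := by
  intro R hR
  have h0 : ∀ ε : ℝ, 0 < ε → 0 ≤ R.1 + ε ∧ 0 ≤ R.2 + ε ∧
      (R.1 ≤ n₁ + ε * (4 + R.1 + ε) ∧ R.1 ≤ max 0 ((n₁ : ℝ) - nₑ) + R.2 + ε * (4 + R.1 + ε)) ∧
      (R.2 ≤ n₂ + ε * (4 + R.2 + ε) ∧ R.2 ≤ max 0 ((n₂ : ℝ) - nₑ) + R.1 + ε * (4 + R.2 + ε)) := by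
    intro ε hε
    have hlarge : ∀ᶠ n : ℕ in atTop, 1 / ε ≤ n := tendsto_natCast_atTop_atTop.eventually_ge_atTop _
    obtain ⟨n, ⟨c, hc⟩, hn, hn0⟩ := ((hR ε hε).and (hlarge.and (eventually_gt_atTop 0))).exists
    have hn0' : (0 : ℝ) < n := by exact_mod_cast hn0
    have hnε : 1 ≤ ε * n := by rwa [div_le_iff₀' hε] at hn
    have hM₁ := c.entropy_M₁
    have hM₂ := c.entropy_M₂
    have b1 := entropy_le_of_shift (l := nₑ) (m := n₁)
      (le_max_right (max n₁ n₂) nₑ) ((le_max_left _ _).trans (le_max_left _ _))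
      c.law c.M₁ c.M₂ (fun ω => ω.2) c.dec₁ (by rw [hM₁, Fintype.card_fin])
      c.mutualInfo_messages hc.reliable₁
    have b2 := entropy_le_of_shift (l := nₑ) (m := n₂)
      (le_max_right (max n₁ n₂) nₑ) ((le_max_right _ _).trans (le_max_left _ _))
      c.law c.M₂ c.M₁ (fun ω => ω.2) c.dec₂ (by rw [hM₂, Fintype.card_fin])
      ((mutualInfo_comm _ _ _).trans c.mutualInfo_messages) hc.reliable₂
    have r1 := hc.rate₁
    have r2 := hc.rate₂
    refine ⟨?_, ?_, rate_le_of_entropy_le hn0' hnε hε.le r1 r2 hc.secret₁ b1.1 b1.2,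
      rate_le_of_entropy_le hn0' hnε hε.le r2 r1 hc.secret₂ b2.1 b2.2⟩
    · have := div_nonneg (entropy_nonneg c.law c.M₁) hn0'.le
      linarith [(abs_le.1 r1).2]
    · have := div_nonneg (entropy_nonneg c.law c.M₂) hn0'.le
      linarith [(abs_le.1 r2).2]
  have p1 : 0 ≤ R.1 := le_of_forall_pos_le_add fun ε hε => (h0 ε hε).1
  have p2 : 0 ≤ R.2 := le_of_forall_pos_le_add fun ε hε => (h0 ε hε).2.1
  have q1 : 0 ≤ 4 + R.1 := by linarith
  have q2 : 0 ≤ 4 + R.2 := by linarith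
  exact ⟨p1, p2,
    le_min (le_of_forall_pos_le_add_mul q1 fun ε hε => (h0 ε hε).2.2.1.1)
      (le_of_forall_pos_le_add_mul q1 fun ε hε => (h0 ε hε).2.2.1.2),
    le_min (le_of_forall_pos_le_add_mul q2 fun ε hε => (h0 ε hε).2.2.2.1)
      (le_of_forall_pos_le_add_mul q2 fun ε hε => (h0 ε hε).2.2.2.2)⟩

/-! ### Achievability -/

theorem floor_div_sub_le {ε x : ℝ} {n : ℕ} (hn : 0 < n) (hnε : 1 ≤ ε * n) (hx : 0 ≤ x) :
    |((⌊n * x⌋₊ : ℕ) : ℝ) / n - x| ≤ ε := by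
  have hn' : (0 : ℝ) < n := by exact_mod_cast hn
  have h1 := Nat.floor_le (mul_nonneg hn'.le hx)
  have h2 := (Nat.lt_floor_add_one (n * x)).le
  have : ((⌊n * x⌋₊ : ℕ) : ℝ) / n - x = (⌊n * x⌋₊ - n * x) / n := by field_simp
  rw [this, abs_le, le_div_iff₀ hn', div_le_iff₀ hn']
  constructor <;> linarith

theorem floor_le_floor_add {x y : ℝ} {n m l : ℕ} (hy : 0 ≤ y)
    (h : x ≤ max 0 ((m : ℝ) - l) + y) : ⌊n * x⌋₊ ≤ ⌊n * y⌋₊ + n * (m - l) := by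
  rw [← Nat.floor_add_natCast (by positivity)]
  refine Nat.floor_le_floor ?_
  have hsub : max 0 ((m : ℝ) - l) = ((m - l : ℕ) : ℝ) := by
    rcases le_total l m with h | h
    · rw [Nat.cast_sub h]; exact max_eq_right (sub_nonneg.2 (Nat.cast_le.2 h))
    · rw [Nat.sub_eq_zero_of_le h, Nat.cast_zero]
      exact max_eq_left (sub_nonpos.2 (Nat.cast_le.2 h))
  rw [hsub] at h
  push_cast
  rw [← mul_add, add_comm y]
  gcongr

theorem floor_mul_le {x : ℝ} {n m : ℕ} (hx : x ≤ m) : ⌊n * x⌋₊ ≤ n * m := by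
  rw [← Nat.floor_natCast (R := ℝ) (n * m)]
  refine Nat.floor_le_floor ?_
  push_cast
  gcongr

/-- `f` encodes two strings of `k₁` and `k₂` bits without error for receivers of gains `m₁`, `m₂`
that know each other's string, and an eavesdropper of gain `l` learns nothing about either string:
any translation of one string can be masked by a translation of the other one. -/
structure IsPerfectCode (q n k₁ k₂ m₁ m₂ l : ℕ)
    (f : (Fin k₁ → ZMod 2) → (Fin k₂ → ZMod 2) → Fin n → Bits q) : Prop where
  recover₁ : ∀ u u' v, (∀ t (j : Fin q), (j : ℕ) < m₁ → f u v t j = f u' v t j) → u = u'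
  recover₂ : ∀ u v v', (∀ t (j : Fin q), (j : ℕ) < m₂ → f u v t j = f u v' t j) → v = v'
  hide₁ : ∀ d, ∃ e, ∀ u v t (j : Fin q), (j : ℕ) < l → f (u + d) (v + e) t j = f u v t j
  hide₂ : ∀ e, ∃ d, ∀ u v t (j : Fin q), (j : ℕ) < l → f (u + d) (v + e) t j = f u v t j

theorem IsPerfectCode.swap {q n k₁ k₂ m₁ m₂ l : ℕ}
    {f : (Fin k₁ → ZMod 2) → (Fin k₂ → ZMod 2) → Fin n → Bits q}
    (h : IsPerfectCode q n k₁ k₂ m₁ m₂ l f) :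
    IsPerfectCode q n k₂ k₁ m₂ m₁ l (fun v u => f u v) where
  recover₁ v v' u := h.recover₂ u v v'
  recover₂ v u u' := h.recover₁ u u' v
  hide₁ e := (h.hide₂ e).imp fun _ hd v u => hd u v
  hide₂ d := (h.hide₁ d).imp fun _ he v u => he u v

/-- The bits to be sent, when `k₂ ≤ k₁`: first the sum of `v` and the first `k₂` bits of `u`, then
zeros up to position `b` if there is room, then the remaining bits of `u`. -/
def layout {k₁ k₂ : ℕ} (hk : k₂ ≤ k₁) (b : ℕ) (u : Fin k₁ → ZMod 2) (v : Fin k₂ → ZMod 2)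
    (p : ℕ) : ZMod 2 :=
  if h : p < k₂ then u ⟨p, h.trans_le hk⟩ + v ⟨p, h⟩
  else if h : max k₂ b ≤ p ∧ p - max k₂ b + k₂ < k₁ then u ⟨p - max k₂ b + k₂, h.2⟩ else 0

section Layout

variable {k₁ k₂ : ℕ} (hk : k₂ ≤ k₁) (b : ℕ)

theorem layout_of_lt (u : Fin k₁ → ZMod 2) (v : Fin k₂ → ZMod 2) {p : ℕ} (h : p < k₂) :
    layout hk b u v p = u ⟨p, h.trans_le hk⟩ + v ⟨p, h⟩ := dif_pos h

theorem layout_private (u : Fin k₁ → ZMod 2) (v : Fin k₂ → ZMod 2) {i : ℕ} (h : k₂ ≤ i)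
    (h' : i < k₁) : layout hk b u v (max k₂ b + (i - k₂)) = u ⟨i, h'⟩ := by
  have h1 : ¬ max k₂ b + (i - k₂) < k₂ := by omega
  have h2 : max k₂ b + (i - k₂) - max k₂ b + k₂ = i := by omega
  simp only [layout, dif_neg h1, h2]
  exact dif_pos ⟨by omega, h'⟩

theorem layout_of_le (u : Fin k₁ → ZMod 2) (v : Fin k₂ → ZMod 2) {p : ℕ} (h : k₂ ≤ p)
    (h' : p < b) : layout hk b u v p = 0 := by
  rw [layout, dif_neg (by omega), dif_neg (by omega)]

end Layout

/-- Position `p` of the layout is sent at level `p / n` in channel use `p % n`, so that the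
eavesdropper sees exactly the positions below `n * l`. There it finds only sums of bits of `u` and
`v`, because the remaining bits of `u` start at position `n * l` or later. -/
theorem isPerfectCode_layout {q n k₁ k₂ m₁ m₂ l : ℕ} (hm₁ : m₁ ≤ q) (hm₂ : m₂ ≤ q)
    (hk : k₂ ≤ k₁) (h₁ : k₁ ≤ n * m₁) (h₂ : k₂ ≤ n * m₂) (h₁₂ : k₁ ≤ k₂ + n * (m₁ - l)) :
    IsPerfectCode q n k₁ k₂ m₁ m₂ l fun u v t j => layout hk (n * l) u v (n * j + t) := by
  have flat {m : ℕ} (hm : m ≤ q) {s s' : ℕ → ZMod 2}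
      (h : ∀ (t : Fin n) (j : Fin q), (j : ℕ) < m → s (n * j + t) = s' (n * j + t)) :
      ∀ p < n * m, s p = s' p := by
    intro p hp
    have hn : 0 < n := Nat.pos_of_mul_pos_right (by omega : 0 < n * m)
    have hj : p / n < m := Nat.div_lt_of_lt_mul hp
    have := h ⟨p % n, Nat.mod_lt _ hn⟩ ⟨p / n, hj.trans_le hm⟩ hj
    simpa only [Nat.div_add_mod] using this
  have pos_lt (t : Fin n) (j : Fin q) (hj : (j : ℕ) < l) : n * (j : ℕ) + t < n * l := by
    calc n * (j : ℕ) + t < n * (j + 1) := by rw [Nat.mul_succ]; omega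
      _ ≤ n * l := Nat.mul_le_mul_left _ hj
  constructor
  · intro u u' v h
    have h' := flat hm₁ h
    ext ⟨i, hi⟩
    rcases lt_or_ge i k₂ with hik | hik
    · have := h' i (by omega)
      rw [layout_of_lt hk _ _ _ hik, layout_of_lt hk _ _ _ hik] at this
      exact add_right_cancel this
    · have hp : max k₂ (n * l) + (i - k₂) < n * m₁ := by
        rw [Nat.mul_sub] at h₁₂
        omega
      have := h' _ hp
      rwa [layout_private hk _ _ _ hik hi, layout_private hk _ _ _ hik hi] at this
  · intro u v v' h
    have h' := flat hm₂ h
    ext ⟨i, hi⟩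
    have := h' i (by omega)
    rw [layout_of_lt hk _ _ _ hi, layout_of_lt hk _ _ _ hi] at this
    exact add_left_cancel this
  · intro d
    refine ⟨fun i => -d ⟨i, by omega⟩, fun u v t j hj => ?_⟩
    rcases lt_or_ge (n * (j : ℕ) + t) k₂ with hp | hp
    · simp only [layout_of_lt hk _ _ _ hp, Pi.add_apply]
      ring
    · simp only [layout_of_le hk _ _ _ hp (pos_lt t j hj)]
  · intro e
    refine ⟨fun i => if h : (i : ℕ) < k₂ then -e ⟨i, h⟩ else 0, fun u v t j hj => ?_⟩
    rcases lt_or_ge (n * (j : ℕ) + t) k₂ with hp | hp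
    · simp only [layout_of_lt hk _ _ _ hp, Pi.add_apply, dif_pos hp]
      ring
    · simp only [layout_of_le hk _ _ _ hp (pos_lt t j hj)]

theorem exists_isPerfectCode {q n k₁ k₂ m₁ m₂ l : ℕ} (hm₁ : m₁ ≤ q) (hm₂ : m₂ ≤ q)
    (h₁ : k₁ ≤ n * m₁) (h₂ : k₂ ≤ n * m₂) (h₁₂ : k₁ ≤ k₂ + n * (m₁ - l))
    (h₂₁ : k₂ ≤ k₁ + n * (m₂ - l)) : ∃ f, IsPerfectCode q n k₁ k₂ m₁ m₂ l f := by
  rcases le_total k₂ k₁ with hk | hk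
  · exact ⟨_, isPerfectCode_layout hm₁ hm₂ hk h₁ h₂ h₁₂⟩
  · exact ⟨_, (isPerfectCode_layout hm₂ hm₁ hk h₂ h₁ h₂₁).swap⟩

/-- If every change `d` of `u` can be compensated by a change `e` of `v` that leaves the
observation `V` as it was, then `V` shares no information with `u`. -/
theorem mutualInfo_fst_eq_zero_of_translate {A B γ : Type} [AddCommGroup A] [AddCommGroup B]
    [Fintype A] [Fintype B] [Fintype γ] (V : A × B → γ)
    (h : ∀ d, ∃ e, ∀ s, V (s + (d, e)) = V s) :
    mutualInfo (PMF.uniformOfFintype (A × B)) Prod.fst V = 0 := by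
  refine mutualInfo_eq_zero_of_prob_const _ _ _ fun a a' b => ?_
  obtain ⟨e, he⟩ := h (a' - a)
  refine prob_uniform_congr (Equiv.addRight (a' - a, e)) _ _ _ fun s => ?_
  simp only [Equiv.coe_addRight, he, Prod.mk.injEq, Prod.fst_add]
  refine and_congr_left fun _ => ?_
  rw [← eq_sub_iff_add_eq, sub_sub_cancel]

/-- A perfect code for bit strings gives a deterministic code for the channel with zero error
probability and zero leakage, once the messages `Fin (2 ^ k)` are read as strings of `k` bits. -/
theorem IsPerfectCode.exists_code {n₁ n₂ nₑ n k₁ k₂ : ℕ}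
    {f : (Fin k₁ → ZMod 2) → (Fin k₂ → ZMod 2) → Fin n → Bits (max (max n₁ n₂) nₑ)}
    (hf : IsPerfectCode (max (max n₁ n₂) nₑ) n k₁ k₂ n₁ n₂ nₑ f) {R : ℝ × ℝ} {ε : ℝ} (hε : 0 ≤ ε)
    (hR₁ : |(k₁ : ℝ) / n - R.1| ≤ ε) (hR₂ : |(k₂ : ℝ) / n - R.2| ≤ ε) :
    ∃ c : Code (Bits (max (max n₁ n₂) nₑ)) (Bits (max (max n₁ n₂) nₑ)) (Bits (max (max n₁ n₂) nₑ))
      n, c.IsDeterministic ∧ c.Meets (linearDetBC n₁ n₂ nₑ) R ε := by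
  have hl₁ : n₁ ≤ max (max n₁ n₂) nₑ := (le_max_left _ _).trans (le_max_left _ _)
  have hl₂ : n₂ ≤ max (max n₁ n₂) nₑ := (le_max_right _ _).trans (le_max_left _ _)
  have hlₑ : nₑ ≤ max (max n₁ n₂) nₑ := le_max_right _ _
  let e (k : ℕ) : Fin (2 ^ k) ≃ (Fin k → ZMod 2) := (Fintype.equivFinOfCardEq (by simp)).symm
  let F : Fin (2 ^ k₁) × Fin (2 ^ k₂) → Fin n → Bits (max (max n₁ n₂) nₑ) :=
    fun m => f (e k₁ m.1) (e k₂ m.2)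
  let W := linearDetBC n₁ n₂ nₑ
  let c : Code (Bits (max (max n₁ n₂) nₑ)) (Bits (max (max n₁ n₂) nₑ))
      (Bits (max (max n₁ n₂) nₑ)) n :=
    { L₁ := 2 ^ k₁
      L₂ := 2 ^ k₂
      ne₁ := ⟨by positivity⟩
      ne₂ := ⟨by positivity⟩
      enc := fun m₁ m₂ => PMF.pure (F (m₁, m₂))
      dec₁ := fun y m₂ => Function.invFun (fun m₁ t => W.y₁ (F (m₁, m₂) t)) y
      dec₂ := fun y m₁ => Function.invFun (fun m₂ t => W.y₂ (F (m₁, m₂) t)) y }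
  have hlaw : c.law = (PMF.uniformOfFintype (Fin (2 ^ k₁) × Fin (2 ^ k₂))).map
      fun m => (m, F m) := by
    simp only [Code.law, c, PMF.pure_map]
    rfl
  have hd₁ (m₂) : Function.Injective fun m₁ t => W.y₁ (F (m₁, m₂) t) := fun m m' h =>
    (e k₁).injective <| hf.recover₁ _ _ _ fun t j hj =>
      (downShift_pow_mulVec_eq_iff hl₁ _ _).1 (congrFun h t) j hj
  have hd₂ (m₁) : Function.Injective fun m₂ t => W.y₂ (F (m₁, m₂) t) := fun m m' h =>
    (e k₂).injective <| hf.recover₂ _ _ _ fun t j hj =>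
      (downShift_pow_mulVec_eq_iff hl₂ _ _).1 (congrFun h t) j hj
  let g (s : (Fin k₁ → ZMod 2) × (Fin k₂ → ZMod 2)) : Fin n → Bits (max (max n₁ n₂) nₑ) :=
    fun t => W.z (f s.1 s.2 t)
  have hs₁ : mutualInfo c.law c.M₁ (c.Z W) = 0 := by
    have h := mutualInfo_fst_eq_zero_of_translate g fun d => (hf.hide₁ d).imp fun x hx s =>
      funext fun t => (downShift_pow_mulVec_eq_iff hlₑ _ _).2 fun j hj => hx s.1 s.2 t j hj
    rw [← map_equiv_uniformOfFintype ((e k₁).prodCongr (e k₂)), mutualInfo_map] at h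
    rw [hlaw, mutualInfo_map]
    exact (mutualInfo_comp_equiv _ _ _ (e k₁)).symm.trans h
  have hs₂ : mutualInfo c.law c.M₂ (c.Z W) = 0 := by
    have h := mutualInfo_fst_eq_zero_of_translate (g ∘ Prod.swap) fun d =>
      (hf.hide₂ d).imp fun x hx s => funext fun t =>
        (downShift_pow_mulVec_eq_iff hlₑ _ _).2 fun j hj => hx s.2 s.1 t j hj
    rw [← map_equiv_uniformOfFintype
      ((Equiv.prodComm _ _).trans ((e k₂).prodCongr (e k₁))), mutualInfo_map] at h
    rw [hlaw, mutualInfo_map]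
    exact (mutualInfo_comp_equiv _ _ _ (e k₂)).symm.trans h
  have hE₁ : c.errorProb₁ W = 0 := by
    rw [Code.errorProb₁, hlaw, PMF.toOuterMeasure_map_apply]
    convert ENNReal.toReal_zero
    convert MeasureTheory.measure_empty (μ := PMF.toOuterMeasure _)
    refine Set.eq_empty_of_forall_notMem fun m hm => hm ?_
    exact (Function.leftInverse_invFun (hd₁ m.2) m.1).symm
  have hE₂ : c.errorProb₂ W = 0 := by
    rw [Code.errorProb₂, hlaw, PMF.toOuterMeasure_map_apply]
    convert ENNReal.toReal_zero
    convert MeasureTheory.measure_empty (μ := PMF.toOuterMeasure _)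
    refine Set.eq_empty_of_forall_notMem fun m hm => hm ?_
    exact (Function.leftInverse_invFun (hd₂ m.1) m.2).symm
  have hlog (k : ℕ) : Real.log ((2 ^ k : ℕ) : ℝ) / Real.log 2 = k := by
    rw [Nat.cast_pow, Nat.cast_ofNat, Real.log_pow, mul_div_cancel_right₀ _ log_two_pos.ne']
  refine ⟨c, ⟨fun m₁ m₂ => F (m₁, m₂), fun _ _ => rfl⟩, ?_, ?_, hE₁.trans_le hε, hE₂.trans_le hε,
    ?_, ?_⟩
  · rwa [c.entropy_M₁, hlog]
  · rwa [c.entropy_M₂, hlog]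
  · rwa [hs₁, zero_div]
  · rwa [hs₂, zero_div]

theorem linearRegion_subset (n₁ n₂ nₑ : ℕ) :
    linearRegion n₁ n₂ nₑ ⊆ capacityRegion (linearDetBC n₁ n₂ nₑ) := by
  rintro R ⟨h1, h2, h3, h4⟩ ε hε
  rw [le_min_iff] at h3 h4
  have hlarge : ∀ᶠ n : ℕ in atTop, 1 / ε ≤ n := tendsto_natCast_atTop_atTop.eventually_ge_atTop _
  filter_upwards [hlarge, eventually_gt_atTop 0] with n hn hn0
  rw [div_le_iff₀' hε] at hn
  obtain ⟨f, hf⟩ := exists_isPerfectCode (q := max (max n₁ n₂) nₑ)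
    ((le_max_left _ _).trans (le_max_left _ _)) ((le_max_right _ _).trans (le_max_left _ _))
    (floor_mul_le (n := n) h3.1) (floor_mul_le h4.1) (floor_le_floor_add h2 h3.2)
    (floor_le_floor_add h1 h4.2)
  exact hf.exists_code hε.le (floor_div_sub_le hn0 hn h1) (floor_div_sub_le hn0 hn h2)

theorem capacityRegion_subset_randomized {𝒳 𝒴₁ 𝒴₂ 𝒵 : Type} [Fintype 𝒵]
    (W : DetBC 𝒳 𝒴₁ 𝒴₂ 𝒵) : capacityRegion W ⊆ randomizedCapacityRegion W :=
  fun _ hR ε hε => (hR ε hε).mono fun _ ⟨c, _, hc⟩ => ⟨c, hc⟩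

end IndividualSecrecy

end

theorem mainTheorem1 (n₁ n₂ nₑ : ℕ) :
    IndividualSecrecy.capacityRegion (IndividualSecrecy.linearDetBC n₁ n₂ nₑ) =
        IndividualSecrecy.linearRegion n₁ n₂ nₑ ∧
      IndividualSecrecy.randomizedCapacityRegion (IndividualSecrecy.linearDetBC n₁ n₂ nₑ) =
        IndividualSecrecy.linearRegion n₁ n₂ nₑ := by
  have h₁ := IndividualSecrecy.linearRegion_subset n₁ n₂ nₑ
  have h₂ := IndividualSecrecy.capacityRegion_subset_randomized
    (IndividualSecrecy.linearDetBC n₁ n₂ nₑ)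
  have h₃ := IndividualSecrecy.randomizedCapacityRegion_subset n₁ n₂ nₑ
  exact ⟨(h₂.trans h₃).antisymm h₁, h₃.antisymm (h₁.trans h₂)⟩
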